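/- Let $k=\mathbb R$ or $k=\mathbb C$, let $\mathfrak g$ be a finite-dimensional Lie algebra over $k$ and let $\mathfrak g_0\subset\mathfrak g$ be a subalgebra of codimension $1$. An ideal of $\mathfrak g$ is called characteristic if it is stable under all derivations of $\mathfrak g$, and the pair $(\mathfrak g,\mathfrak g_0)$ is called almost effective if $\mathfrak g_0$ contains no nonzero characteristic ideal of $\mathfrak g$. Suppose that $(\mathfrak g,\mathfrak g_0)$ is almost effective. Then there is an isomorphism of Lie algebras that carries $\mathfrak g$ onto the first member and $\mathfrak g_0$ onto the second member of one of the following pairs: (i) $(k^n,\,k^{n-1})$ for some $n\ge 1$, where $k^n$ is the abelian Lie algebra and $k^{n-1}\subset k^n$ is the subspace of vectors with last coordinate zero; (ii) $\bigl((kE_n)\ltimes k^n,\,(kE_n)\ltimes k^{n-1}\bigr)$ for some $n\ge 1$, where $E_n$ is the identity matrix of size $n$, the one-dimensional Lie algebra $kE_n\subset\mathfrak{gl}(n,k)$ acts on the abelian ideal $k^n$ by matrix multiplication, $\ltimes$ denotes the semidirect product, and $k^{n-1}\subset k^n$ is as in (i); (iii) $(\mathfrak{sl}(2,k),\,\mathfrak{st}(2,k))$,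 where $\mathfrak{st}(2,k)\subset\mathfrak{sl}(2,k)$ is the subalgebra of upper triangular matrices. -/

import Mathlib

attribute [local instance 100] LieRing.ofAssociativeRing LieAlgebra.ofAssociativeAlgebra

namespace LiePair

section General

variable {k L L' : Type*} [CommRing k] [LieRing L] [LieAlgebra k L] [LieRing L'] [LieAlgebra k L']

/-- An ideal of a Lie algebra is characteristic if it is stable under all derivations. -/
def IsCharacteristic (I : LieIdeal k L) : Prop :=
  ∀ (D : LieDerivation k L L), ∀ x ∈ I, D x ∈ I

/-- The pair `(L, L₀)` is almost effective if `L₀` contains no nonzero characteristic ideal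
of `L`. -/
def AlmostEffective (L₀ : LieSubalgebra k L) : Prop :=
  ∀ I : LieIdeal k L, IsCharacteristic I → (∀ x ∈ I, x ∈ L₀) → I = ⊥

/-- The codimension of the subalgebra `L₀` in `L`, for a finite-dimensional `L`. -/
noncomputable def codim (L₀ : LieSubalgebra k L) : ℕ :=
  Module.finrank k (L ⧸ L₀.toSubmodule)

/-- The pairs `(L, L₀)` and `(L', L₀')` are isomorphic: some isomorphism of Lie algebras
`L ≅ L'` maps `L₀` onto `L₀'`. -/
def Isomorphic (L₀ : LieSubalgebra k L) (L₀' : LieSubalgebra k L') : Prop :=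
  ∃ e : L ≃ₗ⁅k⁆ L', ∀ x : L, e x ∈ L₀' ↔ x ∈ L₀

end General

/-- The vector space `kⁿ`, to be regarded as an abelian Lie algebra. -/
def Abelian (k : Type*) (n : ℕ) : Type _ := Fin n → k

section Models

variable (k : Type*) [Field k]

instance (n : ℕ) : AddCommGroup (Abelian k n) := inferInstanceAs (AddCommGroup (Fin n → k))

instance (n : ℕ) : Module k (Abelian k n) := inferInstanceAs (Module k (Fin n → k))

instance (n : ℕ) : LieRing (Abelian k n) where
  bracket _ _ := 0
  add_lie _ _ _ := (add_zero 0).symm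
  lie_add _ _ _ := (add_zero 0).symm
  lie_self _ := rfl
  leibniz_lie _ _ _ := (add_zero 0).symm

instance (n : ℕ) : LieAlgebra k (Abelian k n) where
  lie_smul t _ _ := (smul_zero t).symm

/-- The subspace `kⁿ` of `kⁿ⁺¹`: the vectors whose last coordinate is zero. -/
def hyperplane (n : ℕ) : LieSubalgebra k (Abelian k (n + 1)) where
  carrier := {v | v (Fin.last n) = 0}
  zero_mem' := rfl
  add_mem' {v w} hv hw := by
    change v (Fin.last n) + w (Fin.last n) = 0
    rw [show v (Fin.last n) = 0 from hv, show w (Fin.last n) = 0 from hw, add_zero]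
  smul_mem' c v hv := by
    change c * v (Fin.last n) = 0
    rw [show v (Fin.last n) = 0 from hv, mul_zero]
  lie_mem' _ _ := rfl

/-- The one-dimensional Lie algebra `k Eₙ` of scalar matrices, spanned in `gl(n, k)` by the
identity matrix `Eₙ`. -/
def scalars (n : ℕ) : LieSubalgebra k (Matrix (Fin n) (Fin n) k) where
  toSubmodule := k ∙ (1 : Matrix (Fin n) (Fin n) k)
  lie_mem' {x y} hx hy := by
    obtain ⟨a, rfl⟩ := Submodule.mem_span_singleton.1 hx
    obtain ⟨b, rfl⟩ := Submodule.mem_span_singleton.1 hy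
    have h : ⁅a • (1 : Matrix (Fin n) (Fin n) k), b • (1 : Matrix (Fin n) (Fin n) k)⁆ = 0 := by
      simp
    simp only [AddSubsemigroup.mem_carrier, AddSubmonoid.mem_toSubsemigroup,
      h, zero_mem]

/-- The natural action of `k Eₙ` on `kⁿ`: a matrix `A` acts by `v ↦ A v`. -/
def scalarsAction (n : ℕ) :
    scalars k n →ₗ⁅k⁆ LieDerivation k (Abelian k n) (Abelian k n) where
  toFun A :=
    { toLinearMap := (Matrix.mulVecLin A.1 : (Fin n → k) →ₗ[k] (Fin n → k))
      leibniz' := fun _ _ => (map_zero (Matrix.mulVecLin A.1)).trans (sub_zero 0).symm }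
  map_add' A B := by
    ext v
    exact Matrix.add_mulVec A.1 B.1 v
  map_smul' c A := by
    ext v
    exact Matrix.smul_mulVec c A.1 v
  map_lie' {A B} := by
    ext v
    change Matrix.mulVec (A.1 * B.1 - B.1 * A.1) v =
      Matrix.mulVec A.1 (Matrix.mulVec B.1 v) - Matrix.mulVec B.1 (Matrix.mulVec A.1 v)
    have h (w : Fin n → k) : Matrix.mulVec (A.1 * B.1 - B.1 * A.1) w =
        Matrix.mulVec A.1 (Matrix.mulVec B.1 w) - Matrix.mulVec B.1 (Matrix.mulVec A.1 w) := by
      rw [Matrix.sub_mulVec, Matrix.mulVec_mulVec, Matrix.mulVec_mulVec]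
    exact h v

/-- The semidirect product `(k Eₙ) ⋉ kⁿ`. -/
abbrev ScalarAffine (n : ℕ) : Type _ :=
  LieAlgebra.SemiDirectSum (Abelian k n) (scalars k n) (scalarsAction k n)

/-- The subalgebra `(k Eₙ₊₁) ⋉ kⁿ` of `(k Eₙ₊₁) ⋉ kⁿ⁺¹`. -/
def scalarAffineHyperplane (n : ℕ) : LieSubalgebra k (ScalarAffine k (n + 1)) where
  carrier := {x | x.left ∈ hyperplane k n}
  zero_mem' := (hyperplane k n).zero_mem
  add_mem' {_ _} hx hy := (hyperplane k n).add_mem hx hy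
  smul_mem' c _ hx := (hyperplane k n).smul_mem c hx
  lie_mem' {x y} hx hy := by
    have key : ∀ A : scalars k (n + 1), ∀ v ∈ hyperplane k n,
        scalarsAction k (n + 1) A v ∈ hyperplane k n := by
      rintro ⟨A, hA⟩ v hv
      obtain ⟨a, rfl⟩ := Submodule.mem_span_singleton.1 hA
      have h : scalarsAction k (n + 1) ⟨a • 1, hA⟩ v = a • v :=
        (Matrix.smul_mulVec a (1 : Matrix (Fin (n + 1)) (Fin (n + 1)) k) v).trans
          (congrArg (a • ·) (Matrix.one_mulVec (v : Fin (n + 1) → k)))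
      rw [h]
      exact (hyperplane k n).smul_mem a hv
    exact (hyperplane k n).sub_mem
      ((hyperplane k n).add_mem ((hyperplane k n).lie_mem hx hy) (key x.right _ hy))
      (key y.right _ hx)

/-- The subalgebra `st(2, k)` of upper triangular matrices in `sl(2, k)`. -/
def st2 : LieSubalgebra k (LieAlgebra.SpecialLinear.sl (Fin 2) k) where
  carrier := {A | A.1 1 0 = 0}
  zero_mem' := rfl
  add_mem' {A B} hA hB := by
    change A.1 1 0 + B.1 1 0 = 0
    rw [show A.1 1 0 = 0 from hA, show B.1 1 0 = 0 from hB, add_zero]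
  smul_mem' c A hA := by
    change c * A.1 1 0 = 0
    rw [show A.1 1 0 = 0 from hA, mul_zero]
  lie_mem' {A B} hA hB := by
    have hA' : A.1 1 0 = 0 := hA
    have hB' : B.1 1 0 = 0 := hB
    change (A.1 * B.1 - B.1 * A.1) 1 0 = 0
    simp [Matrix.mul_apply, Fin.sum_univ_two, hA', hB']

end Models

end LiePair

/-! Write `L₀ = ker f` and split on the radical of the Killing form, a characteristic ideal because
derivations are skew for that form. If it is nonzero, it is solvable, and the last nonzero term of
its derived series is an abelian characteristic ideal `I`. Almost effectivity gives `a ∈ I` with `f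
a = 1`. Then `L` acts on `I / (I ∩ L₀)` by a weight `lam`; a Kleinecke–Shirokov argument shows that
derivations map `L` into `ker lam`, and effectivity upgrades the weight to a scalar action on all of
`I` (`exists_weight_of_abelian`). The ideal `ker lam` is itself abelian, so `L` is abelian if `lam =
0`, and otherwise `L = k h ⊕ ker lam` with `h` acting as the identity (`isomorphic_of_abelian`). If
the Killing form is nondegenerate, all ideals are characteristic, so the filtration `L₀ ⊇ L₁ ⊇ ⋯`
reaches zero. Nilpotency makes `L₁` orthogonal to `L₀`, hence `dim L₁ ≤ 1`; also `dim L₀ / L₁ ≤ 1`.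
Invariance of the form and a change of basis then produce an `sl(2)`-triple
(`isomorphic_st2_of_isKilling`). -/

namespace LiePair

/-! ### Characteristic ideals and the Killing radical -/

section Characteristic

variable {k L : Type*} [CommRing k] [LieRing L] [LieAlgebra k L]

lemma IsCharacteristic.top : IsCharacteristic (⊤ : LieIdeal k L) :=
  fun _ _ _ => LieSubmodule.mem_top _

lemma IsCharacteristic.bot : IsCharacteristic (⊥ : LieIdeal k L) := by
  intro D x hx
  rw [LieSubmodule.mem_bot] at hx ⊢
  rw [hx, map_zero]

lemma IsCharacteristic.lie {I J : LieIdeal k L} (hI : IsCharacteristic I)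
    (hJ : IsCharacteristic J) : IsCharacteristic ⁅I, J⁆ := by
  intro D x hx
  rw [← LieSubmodule.mem_toSubmodule, LieSubmodule.lieIdeal_oper_eq_linear_span'] at hx
  induction hx using Submodule.span_induction with
  | mem x hx =>
    obtain ⟨a, ha, b, hb, rfl⟩ := hx
    rw [LieDerivation.apply_lie_eq_add]
    exact add_mem (LieSubmodule.lie_mem_lie ha (hJ D b hb))
      (LieSubmodule.lie_mem_lie (hI D a ha) hb)
  | zero => simp
  | add x y _ _ hx hy => rw [map_add]; exact add_mem hx hy
  | smul c x _ hx => rw [map_smul]; exact (⁅I, J⁆).toSubmodule.smul_mem c hx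

lemma IsCharacteristic.derivedSeriesOfIdeal {I : LieIdeal k L} (hI : IsCharacteristic I) (n : ℕ) :
    IsCharacteristic (LieAlgebra.derivedSeriesOfIdeal k L n I) := by
  induction n with
  | zero => exact hI
  | succ n ih =>
    rw [LieAlgebra.derivedSeriesOfIdeal_succ]
    exact ih.lie ih

lemma IsCharacteristic.derivedAbelianOfIdeal {I : LieIdeal k L} (hI : IsCharacteristic I) :
    IsCharacteristic (LieAlgebra.derivedAbelianOfIdeal I) := by
  unfold LieAlgebra.derivedAbelianOfIdeal
  split
  · exact IsCharacteristic.bot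
  · exact hI.derivedSeriesOfIdeal _

/-- `ad (D x)` is the commutator of `D` with `ad x`, and the trace is cyclic. -/
lemma killingForm_derivation_apply (D : LieDerivation k L L) (x y : L) :
    killingForm k L (D x) y = -killingForm k L x (D y) := by
  have had (z : L) : LieAlgebra.ad k L (D z) =
      (D : L →ₗ[k] L) ∘ₗ LieAlgebra.ad k L z - LieAlgebra.ad k L z ∘ₗ (D : L →ₗ[k] L) := by
    ext w
    simp
  have hcomm := LinearMap.trace_mul_comm k (D : L →ₗ[k] L)
    (LieAlgebra.ad k L x ∘ₗ LieAlgebra.ad k L y)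
  simp only [Module.End.mul_eq_comp, LinearMap.comp_assoc] at hcomm
  simp only [killingForm_apply_apply, had, LinearMap.sub_comp, LinearMap.comp_sub, map_sub,
    LinearMap.comp_assoc, hcomm, neg_sub]

lemma isCharacteristic_killingCompl_top :
    IsCharacteristic (LieIdeal.killingCompl k L ⊤) := by
  intro D x hx
  rw [LieIdeal.mem_killingCompl] at hx ⊢
  intro y _
  have h := killingForm_derivation_apply D y x
  rw [hx _ (LieSubmodule.mem_top _)] at h
  exact neg_eq_zero.1 h.symm

end Characteristic

/-! ### Hyperplanes as kernels of functionals -/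

section Functional

variable {k : Type*} [Field k]

/-- A nonzero functional on a finite-dimensional space is the last coordinate in a suitable
coordinate system. -/
lemma exists_linearEquiv_last_eq {V : Type*} [AddCommGroup V] [Module k V] [FiniteDimensional k V]
    (f : V →ₗ[k] k) {v₁ : V} (hv₁ : f v₁ = 1) :
    ∃ (n : ℕ) (φ : V ≃ₗ[k] (Fin (n + 1) → k)), ∀ v, φ v (Fin.last n) = f v := by
  let b := Module.finBasis k (LinearMap.ker f)
  let p : V →ₗ[k] LinearMap.ker f :=
    LinearMap.codRestrict _ (LinearMap.id - f.smulRight v₁) (by intro v; simp [hv₁])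
  have hp (v : V) : (p v : V) = v - f v • v₁ := rfl
  let Φ : V →ₗ[k] (Fin (Module.finrank k (LinearMap.ker f) + 1) → k) :=
    LinearMap.pi (Fin.snoc (fun i => b.coord i ∘ₗ p) f)
  have hlast (v : V) : Φ v (Fin.last _) = f v := by simp [Φ]
  have hcast (v : V) (i) : Φ v (Fin.castSucc i) = b.repr (p v) i := by simp [Φ]
  have hinj : Function.Injective Φ := by
    rw [injective_iff_map_eq_zero]
    intro v hv
    have h0 : f v = 0 := by rw [← hlast, hv]; rfl
    have h1 : p v = 0 := by
      apply b.ext_elem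
      intro i
      rw [← hcast, hv]
      simp
    have h2 := hp v
    rw [h1, h0] at h2
    simpa using h2.symm
  have hsurj : Function.Surjective Φ := by
    intro w
    let u : LinearMap.ker f := b.equivFun.symm (fun i => w i.castSucc)
    have hu : f u = 0 := u.2
    have hpv : p (u + w (Fin.last _) • v₁) = u := by
      apply Subtype.ext
      rw [hp]
      simp [hu, hv₁]
    refine ⟨u + w (Fin.last _) • v₁, ?_⟩
    ext i
    refine Fin.lastCases ?_ (fun i => ?_) i
    · rw [hlast]
      simp [hu, hv₁]
    · rw [hcast, hpv]
      exact congrFun (b.equivFun.apply_symm_apply _) i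
  exact ⟨_, LinearEquiv.ofBijective Φ ⟨hinj, hsurj⟩, hlast⟩

variable {L : Type*} [LieRing L] [LieAlgebra k L]

/-- A subalgebra of codimension one is the kernel of a linear functional. -/
lemma exists_functional_of_codim_eq_one {L₀ : LieSubalgebra k L} (h : codim L₀ = 1) :
    ∃ f : L →ₗ[k] k, ∀ x, f x = 0 ↔ x ∈ L₀ := by
  obtain ⟨e⟩ : Nonempty ((L ⧸ L₀.toSubmodule) ≃ₗ[k] k) := by
    have : FiniteDimensional k (L ⧸ L₀.toSubmodule) :=
      FiniteDimensional.of_finrank_pos (by rw [show Module.finrank k _ = 1 from h]; norm_num)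
    exact FiniteDimensional.nonempty_linearEquiv_of_finrank_eq
      (by rw [Module.finrank_self]; exact h)
  refine ⟨e.toLinearMap ∘ₗ L₀.toSubmodule.mkQ, fun x => ?_⟩
  simp

end Functional

/-! ### The Kleinecke–Shirokov theorem -/

section Kleinecke

open Polynomial

variable {k A : Type*} [Field k] [Ring A] [Algebra k A]

/-- Commutation with `D` is a derivation, and its value at `X` commutes with `X`, so the chain rule
takes its commutative form. -/
lemma commutator_aeval {D X : A} (h : Commute X (D * X - X * D)) (q : k[X]) :
    D * aeval X q - aeval X q * D = aeval X (derivative q) * (D * X - X * D) := by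
  have key (q : k[X])
      (hq : D * aeval X q - aeval X q * D = aeval X (derivative q) * (D * X - X * D)) :
      D * aeval X (q * Polynomial.X) - aeval X (q * Polynomial.X) * D =
        aeval X (derivative (q * Polynomial.X)) * (D * X - X * D) := by
    calc D * aeval X (q * Polynomial.X) - aeval X (q * Polynomial.X) * D
        = (D * aeval X q - aeval X q * D) * X + aeval X q * (D * X - X * D) := by
          rw [map_mul, aeval_X]; noncomm_ring
      _ = aeval X (derivative (q * Polynomial.X)) * (D * X - X * D) := by
          rw [hq, mul_assoc, ← h.eq]
          simp only [derivative_mul, derivative_X, map_add, map_mul, aeval_X, mul_one]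
          noncomm_ring
  induction q using Polynomial.induction_on with
  | C a => simp [Algebra.commutes]
  | add p q hp hq =>
    simp only [map_add, add_mul, mul_add] at hp hq ⊢
    rw [← hp, ← hq]
    abel
  | monomial n a hn =>
    rw [pow_succ, ← mul_assoc]
    exact key _ hn

/-- The Kleinecke–Shirokov theorem for algebraic elements in characteristic zero: a commutator
`⁅D, X⁆` that commutes with `X` is nilpotent. -/
lemma isNilpotent_commutator_of_commute [CharZero k] {D X : A} (hX : IsIntegral k X)
    (h : Commute X (D * X - X * D)) : IsNilpotent (D * X - X * D) := by
  set Y := D * X - X * D with hY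
  obtain ⟨p, hp, hpX⟩ := hX
  have hcomm (q : k[X]) : Commute (aeval X q) Y := by
    induction q using Polynomial.induction_on with
    | C a => rw [aeval_C]; exact Algebra.commute_algebraMap_left a Y
    | add p q hp hq => rw [map_add]; exact hp.add_left hq
    | monomial n a _ =>
      simp only [map_mul, aeval_C, map_pow, aeval_X]
      exact (Algebra.commute_algebraMap_left a Y).mul_left (h.pow_left _)
  -- Differentiating the annihilating polynomial down to a nonzero constant leaves a power of `Y`
  -- equal to zero.
  have key (j : ℕ) : ∃ m, aeval X (derivative^[j] p) * Y ^ m = 0 := by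
    induction j with
    | zero => exact ⟨0, by simpa [aeval_def] using hpX⟩
    | succ j ih =>
      obtain ⟨m, hm⟩ := ih
      -- One factor `Y` turns `q'(X)` into the commutator of `D` and `q(X)`; a factor `Y ^ m` on
      -- each side kills its two terms.
      refine ⟨m + (1 + m), ?_⟩
      rw [Function.iterate_succ_apply']
      set q := derivative^[j] p
      have hm' : Y ^ m * aeval X q = 0 := by rw [← ((hcomm q).pow_right m).eq, hm]
      calc aeval X (derivative q) * Y ^ (m + (1 + m))
          = Y ^ m * ((aeval X (derivative q) * Y) * Y ^ m) := by
            rw [pow_add, pow_add, pow_one, ← mul_assoc,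
              ((hcomm (derivative q)).pow_right m).eq]
            simp only [mul_assoc]
        _ = Y ^ m * ((D * aeval X q - aeval X q * D) * Y ^ m) := by
            rw [commutator_aeval h q]
        _ = Y ^ m * D * (aeval X q * Y ^ m) - (Y ^ m * aeval X q) * (D * Y ^ m) := by
            noncomm_ring
        _ = 0 := by rw [hm, hm', mul_zero, zero_mul, sub_zero]
  obtain ⟨m, hm⟩ := key p.natDegree
  refine ⟨m, ?_⟩
  have hconst : derivative^[p.natDegree] p = C (p.natDegree.factorial : k) := by
    rw [eq_C_of_natDegree_le_zero ((natDegree_iterate_derivative p _).trans (Nat.sub_self _).le),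
      coeff_iterate_derivative, zero_add, Nat.descFactorial_self, hp.coeff_natDegree, nsmul_eq_mul,
      mul_one]
  rw [hconst, aeval_C, ← Algebra.smul_def] at hm
  exact (smul_eq_zero_iff_right (Nat.cast_ne_zero.2 (Nat.factorial_ne_zero _))).1 hm

end Kleinecke

/-! ### The weight on an abelian characteristic ideal -/

section AbelianIdeal

variable {k L : Type*} [Field k] [CharZero k] [LieRing L] [LieAlgebra k L] [FiniteDimensional k L]
  {L₀ : LieSubalgebra k L} {f : L →ₗ[k] k}

/-- In an almost effective pair of codimension one, the whole algebra acts by scalars on every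
abelian characteristic ideal that is not contained in the subalgebra. -/
lemma exists_weight_of_abelian (heff : AlmostEffective L₀) (hf : ∀ x, f x = 0 ↔ x ∈ L₀)
    {I : LieIdeal k L} (hI : IsCharacteristic I) (hab : ∀ x ∈ I, ∀ y ∈ I, ⁅x, y⁆ = 0)
    {a : L} (ha : a ∈ I) (hfa : f a = 1) :
    ∃ lam : L →ₗ[k] k, (∀ x, ∀ v ∈ I, ⁅x, v⁆ = lam x • v) ∧
      ∀ (D : LieDerivation k L L) x, lam (D x) = 0 := by
  let lam : L →ₗ[k] k := f ∘ₗ (LieAlgebra.ad k L : L →ₗ[k] Module.End k L).flip a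
  have hlam (x : L) : lam x = f ⁅x, a⁆ := rfl
  have hI' (x : L) {v : L} (hv : v ∈ I) : ⁅x, v⁆ ∈ I := I.lie_mem hv
  -- `I ∩ L₀` is stable under all of `L`: modulo `a`, which acts trivially on `I`, every element
  -- lies in `L₀`.
  have hI₀ (x : L) {v : L} (hv : v ∈ I) (hv0 : f v = 0) : f ⁅x, v⁆ = 0 := by
    have h1 : ⁅x, v⁆ = ⁅x - f x • a, v⁆ := by
      rw [sub_lie, smul_lie, hab a ha v hv, smul_zero, sub_zero]
    rw [h1, hf]
    exact L₀.lie_mem ((hf _).1 (by simp [hfa])) ((hf _).1 hv0)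
  have hfl (x : L) {v : L} (hv : v ∈ I) : f ⁅x, v⁆ = lam x * f v := by
    have h1 := hI₀ x (v := v - f v • a) (sub_mem hv (I.smul_mem _ ha)) (by simp [hfa])
    rw [lie_sub, lie_smul, map_sub, map_smul, smul_eq_mul, ← hlam] at h1
    linear_combination h1
  have hlam_lie {z : L} (hz : z ∈ ⁅(⊤ : LieIdeal k L), (⊤ : LieIdeal k L)⁆) : lam z = 0 := by
    rw [← LieSubmodule.mem_toSubmodule, LieSubmodule.lieIdeal_oper_eq_linear_span'] at hz
    refine (Submodule.span_le (p := LinearMap.ker lam)).2 ?_ hz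
    rintro _ ⟨x, -, y, -, rfl⟩
    change lam ⁅x, y⁆ = 0
    rw [hlam, lie_lie, map_sub, hfl x (hI' y ha), hfl y (hI' x ha), ← hlam, ← hlam]
    ring
  have hder : ⁅⁅(⊤ : LieIdeal k L), (⊤ : LieIdeal k L)⁆, I⁆ = ⊥ := by
    refine heff _ ((IsCharacteristic.top.lie IsCharacteristic.top).lie hI) fun x hx => ?_
    rw [← LieSubmodule.mem_toSubmodule, LieSubmodule.lieIdeal_oper_eq_linear_span'] at hx
    refine (Submodule.span_le (p := L₀.toSubmodule)).2 ?_ hx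
    rintro _ ⟨z, hz, v, hv, rfl⟩
    exact (hf _).1 (by rw [hfl z hv, hlam_lie hz, zero_mul])
  have hcomm (x y : L) {v : L} (hv : v ∈ I) : ⁅x, ⁅y, v⁆⁆ = ⁅y, ⁅x, v⁆⁆ := by
    have h1 : ⁅⁅x, y⁆, v⁆ ∈ ⁅⁅(⊤ : LieIdeal k L), (⊤ : LieIdeal k L)⁆, I⁆ :=
      LieSubmodule.lie_mem_lie (LieSubmodule.lie_mem_lie (LieSubmodule.mem_top _)
        (LieSubmodule.mem_top _)) hv
    rw [hder, LieSubmodule.mem_bot, lie_lie, sub_eq_zero] at h1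
    exact h1
  -- On `I` the commutator of `D` and `ad x` is `ad (D x)`. It commutes with `ad x`, hence is
  -- nilpotent, while `f` is an eigenvector of its transpose with eigenvalue `lam (D x)`.
  have hlamD (D : LieDerivation k L L) (x : L) : lam (D x) = 0 := by
    let T : Module.End k I := (D : L →ₗ[k] L).restrict (p := I.toSubmodule) (hI D)
    let X : Module.End k I :=
      (LieAlgebra.ad k L x : L →ₗ[k] L).restrict (p := I.toSubmodule) fun v hv => hI' x hv
    have hY (v : I) : (((T * X - X * T) v : I) : L) = ⁅D x, (v : L)⁆ := by
      change D ⁅x, (v : L)⁆ - ⁅x, D (v : L)⁆ = _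
      rw [LieDerivation.apply_lie_eq_add]
      abel
    have hXY : Commute X (T * X - X * T) := by
      ext v
      change ⁅x, (((T * X - X * T) v : I) : L)⁆ = (((T * X - X * T) (X v) : I) : L)
      rw [hY, hY]
      exact hcomm x (D x) v.2
    obtain ⟨n, hn⟩ := isNilpotent_commutator_of_commute (Algebra.IsIntegral.isIntegral (R := k) X) hXY
    have hpow (n : ℕ) (v : I) : f (((T * X - X * T) ^ n) v : I) = lam (D x) ^ n * f v := by
      induction n with
      | zero => simp
      | succ n ih =>
        rw [pow_succ', Module.End.mul_apply, hY, hfl _ (Subtype.prop _), ih, pow_succ', mul_assoc]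
    have h1 := hpow n ⟨a, ha⟩
    rw [hn, hfa, mul_one] at h1
    exact eq_zero_of_pow_eq_zero (n := n) (by simpa using h1.symm)
  refine ⟨lam, ?_, hlamD⟩
  -- The obstructions to a scalar action span a characteristic ideal inside `ker f`, so they vanish.
  let S : Set L := {w | ∃ x, ∃ v ∈ I, w = ⁅x, v⁆ - lam x • v}
  have hSlie (y : L) {w : L} (hw : w ∈ S) : ⁅y, w⁆ ∈ S := by
    obtain ⟨x, v, hv, rfl⟩ := hw
    exact ⟨x, ⁅y, v⁆, hI' y hv, by rw [lie_sub, lie_smul, hcomm y x hv]⟩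
  let B : LieIdeal k L :=
    { Submodule.span k S with
      lie_mem := by
        intro y w hw
        exact (Submodule.span_le (p := (Submodule.span k S).comap (LieAlgebra.ad k L y))).2
          (fun w hw => Submodule.subset_span (hSlie y hw)) hw }
  have hBS {w : L} (hw : w ∈ S) : w ∈ B := Submodule.subset_span hw
  have hB : B = ⊥ := by
    refine heff B (fun D w hw => ?_) fun w hw => ?_
    · refine (Submodule.span_le (p := B.toSubmodule.comap (D : L →ₗ[k] L))).2 ?_ hw
      rintro _ ⟨x, v, hv, rfl⟩
      change D (⁅x, v⁆ - lam x • v) ∈ B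
      have h1 : D (⁅x, v⁆ - lam x • v) =
          (⁅x, D v⁆ - lam x • D v) + (⁅D x, v⁆ - lam (D x) • v) := by
        rw [map_sub, map_smul, LieDerivation.apply_lie_eq_add, hlamD, zero_smul]
        abel
      rw [h1]
      exact add_mem (hBS ⟨x, D v, hI D v hv, rfl⟩) (hBS ⟨D x, v, hv, rfl⟩)
    · refine (Submodule.span_le (p := L₀.toSubmodule)).2 ?_ hw
      rintro _ ⟨x, v, hv, rfl⟩
      exact (hf _).1 (by rw [map_sub, hfl x hv, map_smul, smul_eq_mul, sub_self])
  intro x v hv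
  have h1 : ⁅x, v⁆ - lam x • v ∈ B := hBS ⟨x, v, hv, rfl⟩
  rwa [hB, LieSubmodule.mem_bot, sub_eq_zero] at h1

end AbelianIdeal

/-! ### The abelian and scalar affine models -/

section Solvable

variable {k L : Type*} [Field k] [LieRing L] [LieAlgebra k L] [FiniteDimensional k L]
  {L₀ : LieSubalgebra k L} {f : L →ₗ[k] k}

lemma isomorphic_hyperplane (hf : ∀ x, f x = 0 ↔ x ∈ L₀) {a : L} (hfa : f a = 1)
    (hab : ∀ x y : L, ⁅x, y⁆ = 0) : ∃ n, Isomorphic L₀ (hyperplane k n) := by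
  obtain ⟨n, φ, hφ⟩ := exists_linearEquiv_last_eq f hfa
  let e : L ≃ₗ⁅k⁆ Abelian k (n + 1) :=
    { φ with
      map_lie' := fun {x y} => by
        change φ ⁅x, y⁆ = 0
        rw [hab, map_zero] }
  refine ⟨n, e, fun x => ?_⟩
  rw [← hf, ← hφ]
  rfl

/-- The identity matrix, as an element of the Lie algebra of scalar matrices. -/
def scalarOne (k : Type*) [Field k] (n : ℕ) : scalars k n :=
  ⟨1, Submodule.mem_span_singleton_self _⟩

lemma scalarsAction_smul_scalarOne (n : ℕ) (c : k) (v : Abelian k n) :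
    scalarsAction k n (c • scalarOne k n) v = c • v := by
  rw [map_smul]
  exact congrArg (c • ·) (Matrix.one_mulVec (v : Fin n → k))

/-- The hypothesis on `lam` makes `ker lam` abelian with `h` acting on it as the identity;
projecting along `h` therefore determines every bracket. -/
lemma isomorphic_scalarAffineHyperplane (hf : ∀ x, f x = 0 ↔ x ∈ L₀) {lam : L →ₗ[k] k}
    (hlam : ∀ x v, lam v = 0 → ⁅x, v⁆ = lam x • v) {h a : L} (hh : lam h = 1) (hfh : f h = 0)
    (ha : lam a = 0) (hfa : f a = 1) : ∃ n, Isomorphic L₀ (scalarAffineHyperplane k n) := by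
  obtain ⟨n, φ, hφ⟩ : ∃ (n : ℕ) (φ : LinearMap.ker lam ≃ₗ[k] Abelian k (n + 1)),
      ∀ v, φ v (Fin.last n) = f v :=
    exists_linearEquiv_last_eq (f ∘ₗ (LinearMap.ker lam).subtype) (v₁ := ⟨a, ha⟩) hfa
  let p : L →ₗ[k] LinearMap.ker lam :=
    LinearMap.codRestrict _ (LinearMap.id - lam.smulRight h) (by intro v; simp [hh])
  have hp (x : L) : (p x : L) = x - lam x • h := rfl
  have hlie (x y : L) : ⁅x, y⁆ = lam x • (p y : L) - lam y • (p x : L) := by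
    have h1 : ⁅x, (p y : L)⁆ = lam x • (p y : L) := hlam x _ (p y).2
    have h2 : ⁅h, (p x : L)⁆ = (p x : L) := by rw [hlam h _ (p x).2, hh, one_smul]
    have h3 : ⁅x, h⁆ = -(p x : L) := by
      rw [← h2, lie_skew, hp, sub_lie, smul_lie, lie_self, smul_zero, sub_zero]
    calc ⁅x, y⁆ = ⁅x, (p y : L)⁆ + lam y • ⁅x, h⁆ := by
          rw [← lie_smul, ← lie_add, hp, sub_add_cancel]
      _ = _ := by rw [h1, h3, smul_neg, sub_eq_add_neg]
  have hlam_lie (x y : L) : lam ⁅x, y⁆ = 0 := by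
    rw [hlie, map_sub, map_smul, map_smul, show lam (p x) = 0 from (p x).2,
      show lam (p y) = 0 from (p y).2, smul_zero, smul_zero, sub_zero]
  have hp_lie (x y : L) : p ⁅x, y⁆ = lam x • p y - lam y • p x := by
    apply Subtype.ext
    rw [hp, hlam_lie, zero_smul, sub_zero, hlie]
    rfl
  let ψ : L →ₗ⁅k⁆ ScalarAffine k (n + 1) :=
    { toFun := fun x => ⟨φ (p x), lam x • scalarOne k (n + 1)⟩
      map_add' := fun x y => congrArg₂ LieAlgebra.SemiDirectSum.mk
        (by rw [map_add, map_add]; rfl) (by rw [map_add, add_smul]; rfl)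
      map_smul' := fun c x => congrArg₂ LieAlgebra.SemiDirectSum.mk
        (by rw [map_smul, map_smul]; rfl) (by rw [map_smul, smul_eq_mul, mul_smul]; rfl)
      map_lie' := fun {x y} => congrArg₂ LieAlgebra.SemiDirectSum.mk
        (by
          rw [scalarsAction_smul_scalarOne, scalarsAction_smul_scalarOne, hp_lie, map_sub,
            map_smul, map_smul]
          exact congrArg (· - _) (zero_add _).symm)
        (by rw [hlam_lie, zero_smul, smul_lie, lie_smul, lie_self, smul_zero, smul_zero]) }
  have hbij : Function.Bijective ψ := by
    constructor
    · rw [injective_iff_map_eq_zero]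
      intro x hx
      have h1 : φ (p x) = 0 := congrArg LieAlgebra.SemiDirectSum.left hx
      have h2 : lam x • scalarOne k (n + 1) = 0 := congrArg LieAlgebra.SemiDirectSum.right hx
      have h3 : scalarOne k (n + 1) ≠ 0 := fun h0 => one_ne_zero (congrArg Subtype.val h0)
      rw [smul_eq_zero_iff_left h3] at h2
      rw [φ.map_eq_zero_iff] at h1
      have h4 := hp x
      rw [h1, h2, zero_smul, sub_zero] at h4
      exact h4.symm
    · rintro ⟨v, A, hA⟩
      obtain ⟨c, rfl⟩ := Submodule.mem_span_singleton.1 hA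
      have h1 : lam (φ.symm v) = 0 := (φ.symm v).2
      have h2 : lam (φ.symm v + c • h) = c := by simp [h1, hh]
      refine ⟨φ.symm v + c • h, congrArg₂ LieAlgebra.SemiDirectSum.mk ?_ ?_⟩
      · rw [← φ.eq_symm_apply]
        apply Subtype.ext
        rw [hp, h2, add_sub_cancel_right]
      · rw [h2]
        rfl
  refine ⟨n, LieEquiv.ofBijective ψ hbij, fun x => ?_⟩
  change φ (p x) (Fin.last n) = 0 ↔ _
  rw [hφ, ← hf]
  rw [hp, map_sub, map_smul, hfh, smul_zero, sub_zero]

/-- An almost effective pair of codimension one that has a nonzero abelian characteristic ideal. -/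
lemma isomorphic_of_abelian [CharZero k] (heff : AlmostEffective L₀) (hf : ∀ x, f x = 0 ↔ x ∈ L₀)
    {I : LieIdeal k L} (hI : IsCharacteristic I) (hab : ∀ x ∈ I, ∀ y ∈ I, ⁅x, y⁆ = 0)
    (hI0 : I ≠ ⊥) :
    (∃ n : ℕ, Isomorphic L₀ (hyperplane k n)) ∨
    (∃ n : ℕ, Isomorphic L₀ (scalarAffineHyperplane k n)) := by
  obtain ⟨a, ha, hfa⟩ : ∃ a ∈ I, f a = 1 := by
    by_contra! hne
    refine hI0 (heff I hI fun x hx => (hf x).1 ?_)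
    by_contra hfx
    exact hne _ (I.smul_mem (f x)⁻¹ hx) (by rw [map_smul, smul_eq_mul, inv_mul_cancel₀ hfx])
  have ha0 : a ≠ 0 := by rintro rfl; simp at hfa
  obtain ⟨lam, hlam, hlamD⟩ := exists_weight_of_abelian heff hf hI hab ha hfa
  have hlam_lie (x y : L) : lam ⁅x, y⁆ = 0 := by
    simpa using hlamD (LieDerivation.ad k L x) y
  have hlamI {v : L} (hv : v ∈ I) : lam v = 0 := by
    have h1 := hlam v a ha
    rw [hab v hv a ha, eq_comm] at h1
    exact (smul_eq_zero_iff_left ha0).1 h1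
  let C : LieIdeal k L := { LinearMap.ker lam with lie_mem := fun {x y} _ => hlam_lie x y }
  have hC {x : L} : x ∈ C ↔ lam x = 0 := Iff.rfl
  have hCchar : IsCharacteristic C := fun D x _ => hlamD D x
  have hCC : ⁅C, C⁆ = ⊥ := by
    refine heff _ (hCchar.lie hCchar) fun x hx => ?_
    rw [← LieSubmodule.mem_toSubmodule, LieSubmodule.lieIdeal_oper_eq_linear_span'] at hx
    refine (Submodule.span_le (p := L₀.toSubmodule)).2 ?_ hx
    rintro _ ⟨x, hx, y, hy, rfl⟩
    have hxa : ⁅x, a⁆ = 0 := by rw [hlam x a ha, hC.1 hx, zero_smul]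
    have hya : ⁅a, y⁆ = 0 := by rw [← lie_skew, hlam y a ha, hC.1 hy, zero_smul, neg_zero]
    -- Since `a` commutes with `C`, both factors may be moved into `L₀`.
    have h1 : ⁅x, y⁆ = ⁅x - f x • a, y - f y • a⁆ := by
      simp [hxa, hya]
    rw [h1]
    exact L₀.lie_mem ((hf _).1 (by simp [hfa])) ((hf _).1 (by simp [hfa]))
  have hCab (x : L) (hx : x ∈ C) (y : L) (hy : y ∈ C) : ⁅x, y⁆ = 0 := by
    have h1 : ⁅x, y⁆ ∈ ⁅C, C⁆ := LieSubmodule.lie_mem_lie hx hy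
    rwa [hCC, LieSubmodule.mem_bot] at h1
  by_cases h0 : lam = 0
  · exact Or.inl (isomorphic_hyperplane hf hfa fun x y =>
      hCab x (by rw [hC, h0]; rfl) y (by rw [hC, h0]; rfl))
  · obtain ⟨g, hg⟩ : ∃ g, lam g = 1 := LinearMap.surjective h0 1
    -- The weight argument applies again to the larger ideal `C`; the two weights agree because both
    -- can be read off on `a`.
    obtain ⟨mu, hmu, -⟩ := exists_weight_of_abelian heff hf hCchar hCab (hC.2 (hlamI ha)) hfa
    have hmulam (x : L) : mu x = lam x :=
      smul_left_injective k ha0 ((hmu x a (hC.2 (hlamI ha))).symm.trans (hlam x a ha))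
    exact Or.inr (isomorphic_scalarAffineHyperplane hf (lam := lam) (h := g - f g • a) (a := a)
      (fun x v hv => by rw [hmu x v hv, hmulam])
      (by simp [hg, hlamI ha]) (by simp [hfa]) (hlamI ha) hfa)

end Solvable

/-! ### The filtration defined by a subalgebra -/

section Filtration

variable {k L : Type*} [CommRing k] [LieRing L] [LieAlgebra k L]

/-- The canonical descending filtration of a Lie algebra defined by a subalgebra `L₀`: each term
consists of the elements that map the whole algebra into the preceding term. -/
def filtration (L₀ : LieSubalgebra k L) : ℕ → Submodule k L
  | 0 => L₀.toSubmodule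
  | n + 1 =>
    filtration L₀ n ⊓ ⨅ y : L, (filtration L₀ n).comap ((LieAlgebra.ad k L : L →ₗ[k] Module.End k L).flip y)

variable {L₀ : LieSubalgebra k L}

lemma mem_filtration_succ {n : ℕ} {x : L} :
    x ∈ filtration L₀ (n + 1) ↔ x ∈ filtration L₀ n ∧ ∀ y, ⁅x, y⁆ ∈ filtration L₀ n := by
  simp [filtration]

lemma filtration_antitone : Antitone (filtration L₀) :=
  antitone_nat_of_succ_le fun _ _ hx => (mem_filtration_succ.1 hx).1

lemma lie_mem_filtration {x : L} (hx : x ∈ L₀) {n : ℕ} {z : L} (hz : z ∈ filtration L₀ n) :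
    ⁅x, z⁆ ∈ filtration L₀ n := by
  induction n generalizing z with
  | zero => exact L₀.lie_mem hx hz
  | succ n ih =>
    rw [mem_filtration_succ] at hz ⊢
    refine ⟨ih hz.1, fun w => ?_⟩
    rw [lie_lie]
    exact sub_mem (ih (hz.2 w)) (hz.2 _)

/-- The degree-one case of the grading rule; the Leibniz identity reduces it to the degree-zero case
`lie_mem_filtration`. -/
lemma lie_mem_filtration_succ {x : L} (hx : x ∈ filtration L₀ 1) {n : ℕ} {z : L}
    (hz : z ∈ filtration L₀ n) : ⁅x, z⁆ ∈ filtration L₀ (n + 1) := by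
  have hx' := mem_filtration_succ.1 hx
  induction n generalizing z with
  | zero =>
    rw [← lie_skew]
    exact neg_mem (lie_mem_filtration hz hx)
  | succ n ih =>
    have hz' := mem_filtration_succ.1 hz
    rw [mem_filtration_succ]
    refine ⟨lie_mem_filtration hx'.1 hz, fun w => ?_⟩
    rw [lie_lie]
    refine sub_mem (ih (hz'.2 w)) ?_
    rw [← lie_skew]
    exact neg_mem (lie_mem_filtration (hx'.2 w) hz)

/-- If the filtration defined by `L₀` reaches zero then `L₀` is orthogonal to its first term with
respect to the Killing form. -/
lemma killingForm_eq_zero_of_mem_filtration_one [IsReduced k] {n : ℕ} (hn : filtration L₀ n = ⊥)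
    {x y : L} (hx : x ∈ filtration L₀ 1) (hy : y ∈ L₀) : killingForm k L x y = 0 := by
  rw [killingForm_apply_apply]
  refine (LinearMap.isNilpotent_trace_of_isNilpotent ⟨n + 1, ?_⟩).eq_zero
  -- The first application only lands in `L₀`, the term of index zero; each later one raises the
  -- index by one.
  have key (m : ℕ) (z : L) :
      ((LieAlgebra.ad k L x ∘ₗ LieAlgebra.ad k L y) ^ (m + 1)) z ∈ filtration L₀ m := by
    induction m with
    | zero => simpa using (mem_filtration_succ.1 hx).2 ⁅y, z⁆
    | succ m ih =>
      rw [pow_succ', Module.End.mul_apply]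
      exact lie_mem_filtration_succ hx (lie_mem_filtration hy ih)
  ext z
  have h1 := key n z
  rwa [hn] at h1

end Filtration

/-! ### Nondegenerate Killing form and `sl(2)` -/

section Semisimple

variable {k L : Type*} [Field k] [LieRing L] [LieAlgebra k L] {L₀ : LieSubalgebra k L}
  {f : L →ₗ[k] k}

/-- A basis of `L` that satisfies the relations of `sl(2)` and is adapted to `L₀` identifies
`(L, L₀)` with `(sl(2), st(2))`. -/
lemma isomorphic_st2 (hf : ∀ x, f x = 0 ↔ x ∈ L₀) {h u e : L} (hh : f h = 0) (hu : f u = 0)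
    (he : f e = 1) (hhu : ⁅h, u⁆ = (2 : k) • u) (hhe : ⁅h, e⁆ = -(2 : k) • e) (hue : ⁅u, e⁆ = h)
    (hu0 : u ≠ 0) (h2 : (2 : k) ≠ 0) (hspan : ∀ x, f x = 0 → ∃ s t : k, x = s • h + t • u) :
    Isomorphic L₀ (st2 k) := by
  have hsl (A : LieAlgebra.SpecialLinear.sl (Fin 2) k) : A.1 1 1 = -A.1 0 0 := by
    have h1 : Matrix.trace A.1 = 0 := A.2
    rw [Matrix.trace_fin_two] at h1
    linear_combination h1
  let ψ : LieAlgebra.SpecialLinear.sl (Fin 2) k →ₗ⁅k⁆ L :=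
    { toFun := fun A => A.1 0 0 • h + A.1 0 1 • u + A.1 1 0 • e
      map_add' := fun A B => by
        change (A.1 0 0 + B.1 0 0) • h + (A.1 0 1 + B.1 0 1) • u + (A.1 1 0 + B.1 1 0) • e = _
        module
      map_smul' := fun c A => by
        change (c * A.1 0 0) • h + (c * A.1 0 1) • u + (c * A.1 1 0) • e = _
        rw [RingHom.id_apply]
        module
      map_lie' := fun {A B} => by
        have hAB : (⁅A, B⁆ : LieAlgebra.SpecialLinear.sl (Fin 2) k).1 = A.1 * B.1 - B.1 * A.1 := rfl
        have huh : ⁅u, h⁆ = -(2 : k) • u := by rw [← lie_skew, hhu, neg_smul]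
        have heh : ⁅e, h⁆ = (2 : k) • e := by rw [← lie_skew, hhe, neg_smul, neg_neg]
        have heu : ⁅e, u⁆ = -h := by rw [← lie_skew, hue]
        simp only [hAB, Matrix.sub_apply, Matrix.mul_apply, Fin.sum_univ_two, hsl, add_lie, lie_add,
          smul_lie, lie_smul, lie_self, hhu, hhe, hue, huh, heh, heu]
        module }
  have hψ (A) : ψ A = A.1 0 0 • h + A.1 0 1 • u + A.1 1 0 • e := rfl
  have hfψ (A) : f (ψ A) = A.1 1 0 := by simp [hψ, hh, hu, he]
  have hbij : Function.Bijective ψ := by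
    constructor
    · rw [injective_iff_map_eq_zero]
      intro A hA
      have h10 : A.1 1 0 = 0 := by rw [← hfψ, hA, map_zero]
      rw [hψ, h10, zero_smul, add_zero] at hA
      have h00 : A.1 0 0 = 0 := by
        -- Bracketing with `e` and applying `f` isolates the coefficient of `h`.
        have h1 : f ⁅A.1 0 0 • h + A.1 0 1 • u, e⁆ = 0 := by rw [hA, zero_lie, map_zero]
        simpa [hhe, hue, hh, he, h2] using h1
      rw [h00, zero_smul, zero_add, smul_eq_zero_iff_left hu0] at hA
      apply Subtype.ext
      ext i j
      fin_cases i <;> fin_cases j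
      · exact h00
      · exact hA
      · exact h10
      · exact (hsl A).trans (by rw [h00, neg_zero]; rfl)
    · intro x
      obtain ⟨s, t, hst⟩ := hspan (x - f x • e) (by simp [he])
      refine ⟨⟨!![s, t; f x, -s], ?_⟩, ?_⟩
      · change Matrix.trace !![s, t; f x, -s] = 0
        simp [Matrix.trace_fin_two]
      · rw [hψ]
        change s • h + t • u + f x • e = x
        rw [← hst, sub_add_cancel]
  refine ⟨(LieEquiv.ofBijective ψ hbij).symm, fun x => ?_⟩
  obtain ⟨A, rfl⟩ := hbij.2 x
  have h1 : (LieEquiv.ofBijective ψ hbij).symm (ψ A) = A :=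
    (LieEquiv.ofBijective ψ hbij).symm_apply_apply A
  rw [h1, ← hf, hfψ]
  rfl

variable [FiniteDimensional k L]

/-- All derivations are inner. -/
lemma isCharacteristic_of_isKilling [LieAlgebra.IsKilling k L] (I : LieIdeal k L) :
    IsCharacteristic I := by
  intro D x hx
  obtain ⟨y, rfl⟩ := LieDerivation.IsKilling.exists_eq_ad D
  simpa using I.lie_mem (x := y) hx

/-- A term where the filtration stalls is an ideal contained in `L₀`. -/
lemma filtration_eq_bot_of_succ_eq [LieAlgebra.IsKilling k L] (heff : AlmostEffective L₀) {n : ℕ}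
    (hn : filtration L₀ (n + 1) = filtration L₀ n) : filtration L₀ n = ⊥ := by
  let I : LieIdeal k L :=
    { filtration L₀ n with
      lie_mem := fun {y x} hx => by
        have hx' : x ∈ filtration L₀ (n + 1) := by rw [hn]; exact hx
        have h1 := neg_mem ((mem_filtration_succ.1 hx').2 y)
        rwa [lie_skew] at h1 }
  have hI : I = ⊥ := heff I (isCharacteristic_of_isKilling I) fun x hx =>
    filtration_antitone (Nat.zero_le n) hx
  exact congrArg LieSubmodule.toSubmodule hI

lemma exists_filtration_eq_bot [LieAlgebra.IsKilling k L] (heff : AlmostEffective L₀) :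
    ∃ n, filtration L₀ n = ⊥ := by
  obtain ⟨n, hn⟩ := IsArtinian.monotone_stabilizes
    (⟨fun n => OrderDual.toDual (filtration L₀ n), filtration_antitone⟩ : ℕ →o (Submodule k L)ᵒᵈ)
  exact ⟨n, filtration_eq_bot_of_succ_eq heff (hn (n + 1) n.le_succ).symm⟩

/-- An element that spans an ideal is zero if the Killing form is nondegenerate. -/
lemma eq_zero_of_forall_lie_mem_span [LieAlgebra.IsKilling k L] {z : L}
    (hz : ∀ x : L, ∃ c : k, ⁅x, z⁆ = c • z) : z = 0 := by
  let I : LieIdeal k L :=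
    { k ∙ z with
      lie_mem := fun {x w} hw => by
        obtain ⟨c, rfl⟩ := Submodule.mem_span_singleton.1 hw
        obtain ⟨d, hd⟩ := hz x
        rw [lie_smul, hd]
        exact Submodule.smul_mem _ _ (Submodule.smul_mem _ _ (Submodule.mem_span_singleton_self z)) }
  have hab : IsLieAbelian I := ⟨by
    rintro ⟨x, hx⟩ ⟨y, hy⟩
    obtain ⟨c, rfl⟩ := Submodule.mem_span_singleton.1 hx
    obtain ⟨d, rfl⟩ := Submodule.mem_span_singleton.1 hy
    apply Subtype.ext
    change ⁅c • z, d • z⁆ = 0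
    simp⟩
  have hI := LieAlgebra.IsKilling.ideal_eq_bot_of_isLieAbelian I
  have hzI : z ∈ I := Submodule.mem_span_singleton_self z
  rwa [hI, LieSubmodule.mem_bot] at hzI

/-- An almost effective pair of codimension one with nondegenerate Killing form. -/
lemma isomorphic_st2_of_isKilling [CharZero k] [LieAlgebra.IsKilling k L]
    (heff : AlmostEffective L₀) (hf : ∀ x, f x = 0 ↔ x ∈ L₀) {e : L} (he : f e = 1) :
    Isomorphic L₀ (st2 k) := by
  obtain ⟨N, hN⟩ := exists_filtration_eq_bot heff
  have h2 : (2 : k) ≠ 0 := two_ne_zero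
  have hF {x : L} : x ∈ filtration L₀ 1 ↔ f x = 0 ∧ f ⁅x, e⁆ = 0 := by
    rw [mem_filtration_succ]
    refine ⟨fun hx => ⟨(hf x).2 hx.1, (hf _).2 (hx.2 e)⟩,
      fun hx => ⟨(hf x).1 hx.1, fun y => (hf _).1 ?_⟩⟩
    have h1 : f ⁅x, y - f y • e⁆ = 0 :=
      (hf _).2 (L₀.lie_mem ((hf x).1 hx.1) ((hf _).1 (by simp [he])))
    simpa [hx.2] using h1
  have hκ {x y : L} (hx : x ∈ filtration L₀ 1) (hy : f y = 0) : killingForm k L x y = 0 :=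
    killingForm_eq_zero_of_mem_filtration_one hN hx ((hf y).1 hy)
  have hκe {x : L} (hx : x ∈ filtration L₀ 1) (hxe : killingForm k L x e = 0) : x = 0 := by
    have h1 : x ∈ LinearMap.ker (killingForm k L) := by
      ext y
      have h3 := hκ hx (y := y - f y • e) (by simp [he])
      simpa [hxe] using h3
    rwa [LieAlgebra.IsKilling.ker_killingForm_eq_bot, Submodule.mem_bot] at h1
  -- Otherwise the filtration stalls at once, so `L₀ = 0` and `e` spans an ideal. The value `-2` is
  -- the weight of `e` in an `sl(2)`-triple.
  obtain ⟨h, hh, hhe⟩ : ∃ h, f h = 0 ∧ f ⁅h, e⁆ = -2 := by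
    obtain ⟨h, hh, hhe⟩ : ∃ h, f h = 0 ∧ f ⁅h, e⁆ ≠ 0 := by
      by_contra! hne
      have h0 : filtration L₀ 0 = ⊥ := filtration_eq_bot_of_succ_eq heff
        (le_antisymm (filtration_antitone (Nat.zero_le 1))
          fun x hx => hF.2 ⟨(hf x).2 hx, hne x ((hf x).2 hx)⟩)
      have h1 : e = 0 := eq_zero_of_forall_lie_mem_span fun x => ⟨(0 : k), by
        have h3 : x - f x • e ∈ filtration L₀ 0 := (hf _).1 (by simp [he])
        rw [h0, Submodule.mem_bot, sub_eq_zero] at h3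
        rw [h3, smul_lie, lie_self, smul_zero, zero_smul]⟩
      simp [h1] at he
    exact ⟨(-2 / f ⁅h, e⁆) • h, by simp [hh], by simp [hhe]⟩
  have hdec (h' : L) (hh' : f h' = 0) (hhe' : f ⁅h', e⁆ = -2) (x : L) (hx : f x = 0) :
      ∃ s : k, x - s • h' ∈ filtration L₀ 1 :=
    ⟨-(f ⁅x, e⁆ / 2), hF.2 ⟨by simp [hx, hh'], by
      rw [sub_lie, smul_lie, map_sub, map_smul, hhe', smul_eq_mul]
      field_simp
      ring⟩⟩
  -- Otherwise `h` and `e` span `L`, and `⁅h, e⁆` spans an ideal.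
  obtain ⟨u, huF, hu0⟩ : ∃ u ∈ filtration L₀ 1, u ≠ 0 := by
    by_contra! hne
    have hdec' (x : L) (hx : f x = 0) : ∃ s : k, x = s • h := by
      obtain ⟨s, hs⟩ := hdec h hh hhe x hx
      exact ⟨s, sub_eq_zero.1 (hne _ hs)⟩
    obtain ⟨c, hc⟩ := hdec' (⁅h, e⁆ + (2 : k) • e) (by simp [hhe, he])
    have hc' : ⁅h, e⁆ = c • h - (2 : k) • e := by rw [← hc, add_sub_cancel_right]
    have h0 : ⁅h, e⁆ = 0 := eq_zero_of_forall_lie_mem_span fun x => by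
      obtain ⟨s, hs⟩ := hdec' (x - f x • e) (by simp [he])
      refine ⟨-2 * s - c * f x, ?_⟩
      have h1 : ⁅e, h⁆ = -⁅h, e⁆ := (lie_skew _ _).symm
      have h3 : ⁅x, ⁅h, e⁆⁆ = ⁅s • h + f x • e, c • h - (2 : k) • e⁆ := by
        rw [← hs, sub_add_cancel, hc']
      rw [h3]
      simp only [add_lie, lie_sub, smul_lie, lie_smul, lie_self, h1]
      module
    rw [h0, map_zero] at hhe
    exact h2 (neg_eq_zero.1 hhe.symm)
  have hκu : killingForm k L u e ≠ 0 := fun h0 => hu0 (hκe huF h0)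
  have hFu (x : L) (hx : x ∈ filtration L₀ 1) : ∃ t : k, x = t • u := by
    refine ⟨killingForm k L x e / killingForm k L u e, sub_eq_zero.1 (hκe ?_ ?_)⟩
    · exact sub_mem hx (Submodule.smul_mem _ _ huF)
    · simp [hκu]
  have hspan (h' : L) (hh' : f h' = 0) (hhe' : f ⁅h', e⁆ = -2) (x : L) (hx : f x = 0) :
      ∃ s t : k, x = s • h' + t • u := by
    obtain ⟨s, hs⟩ := hdec h' hh' hhe' x hx
    obtain ⟨t, ht⟩ := hFu _ hs
    exact ⟨s, t, by rw [← ht, add_sub_cancel]⟩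
  obtain ⟨hu, hue⟩ := hF.1 huF
  -- The eigenvalue comes from invariance of the Killing form: `⁅h, e⁆` is `-2 e` modulo `L₀`, and
  -- `u` is orthogonal to `L₀`.
  have hhu : ⁅h, u⁆ = (2 : k) • u := by
    obtain ⟨r, hr⟩ := hFu _ (lie_mem_filtration ((hf h).1 hh) huF)
    have h1 : killingForm k L ⁅u, h⁆ e = killingForm k L u ⁅h, e⁆ :=
      LieModule.traceForm_apply_lie_apply k L L u h e
    have h3 := hκ huF (y := ⁅h, e⁆ + (2 : k) • e) (by simp [hhe, he])
    rw [map_add, map_smul, smul_eq_mul, ← h1, ← lie_skew, hr, map_neg, LinearMap.neg_apply,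
      map_smul, LinearMap.smul_apply, smul_eq_mul, ← sub_eq_neg_add, ← sub_mul, mul_eq_zero,
      or_iff_left hκu, sub_eq_zero] at h3
    rw [hr, h3]
  obtain ⟨α, β, hαβ⟩ := hspan h hh hhe _ hue
  have hα : α ≠ 0 := by
    rintro rfl
    have h1 : killingForm k L ⁅u, e⁆ h = killingForm k L u ⁅e, h⁆ :=
      LieModule.traceForm_apply_lie_apply k L L u e h
    have h3 := hκ huF (y := ⁅h, e⁆ + (2 : k) • e) (by simp [hhe, he])
    rw [hαβ, zero_smul, zero_add, map_smul, LinearMap.smul_apply, hκ huF hh, smul_zero,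
      ← lie_skew, map_neg, eq_comm, neg_eq_zero] at h1
    rw [map_add, h1, zero_add, map_smul, smul_eq_mul, mul_eq_zero] at h3
    exact h3.elim h2 hκu
  have hαβ' : α⁻¹ • ⁅u, e⁆ = h + (α⁻¹ * β) • u := by
    rw [hαβ, smul_add, smul_smul, smul_smul, inv_mul_cancel₀ hα, one_smul]
  -- Replacing `h` by a multiple of `⁅u, e⁆` changes it only by a multiple of `u`, so the earlier
  -- relations persist.
  obtain ⟨h', hh'⟩ : ∃ h', h' = α⁻¹ • ⁅u, e⁆ := ⟨_, rfl⟩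
  rw [← hh'] at hαβ'
  have hfh' : f h' = 0 := by rw [hh', map_smul, hue, smul_zero]
  have hfhe' : f ⁅h', e⁆ = -2 := by
    rw [hαβ', add_lie, smul_lie, map_add, map_smul, hhe, hue, smul_zero, add_zero]
  have hhu' : ⁅h', u⁆ = (2 : k) • u := by
    rw [hαβ', add_lie, smul_lie, lie_self, smul_zero, add_zero, hhu]
  have hue' : ⁅u, e⁆ = α • h' := by rw [hh', smul_smul, mul_inv_cancel₀ hα, one_smul]
  obtain ⟨γ, δ, hγδ⟩ := hspan h' hfh' hfhe' (⁅h', e⁆ + (2 : k) • e) (by simp [hfhe', he])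
  have hhe' : ⁅h', e⁆ = γ • h' + δ • u - (2 : k) • e := by rw [← hγδ, add_sub_cancel_right]
  -- Apply `ad h'` to the relation `⁅u, e⁆ = α h'`: what remains is a multiple of `γ u`.
  have hγ : γ = 0 := by
    have h1 : ⁅h', ⁅u, e⁆⁆ = 0 := by rw [hue', lie_smul, lie_self, smul_zero]
    have huh' : ⁅u, h'⁆ = -((2 : k) • u) := by rw [← lie_skew, hhu']
    rw [leibniz_lie, hhu', hhe', smul_lie, lie_sub, lie_add, lie_smul, lie_smul, lie_smul, lie_self,
      huh', smul_zero, add_zero, add_sub_cancel, smul_neg, neg_eq_zero, smul_smul,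
      smul_eq_zero_iff_left hu0] at h1
    exact (mul_eq_zero.1 h1).resolve_right h2
  rw [hγ, zero_smul, zero_add] at hhe'
  -- The eigenvalues of `ad h'` on `u` and of the target on `e` differ by `4`, so this shift of `e`
  -- removes the term `δ u`; scaling `u` absorbs `α`.
  refine isomorphic_st2 hf (h := h') (u := α⁻¹ • u) (e := e - (δ / 4) • u) hfh' (by simp [hu])
    (by simp [he, hu]) (by rw [lie_smul, hhu', smul_comm]) ?_ ?_
    (smul_ne_zero (inv_ne_zero hα) hu0) h2 fun x hx => ?_
  · rw [lie_sub, lie_smul, hhu', hhe']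
    module
  · rw [smul_lie, lie_sub, lie_smul, lie_self, smul_zero, sub_zero, hh']
  · obtain ⟨s, t, hst⟩ := hspan h' hfh' hfhe' x hx
    exact ⟨s, t * α, by rw [hst, mul_smul, smul_inv_smul₀ hα]⟩

end Semisimple

end LiePair

theorem mainTheorem7 {k : Type*} [RCLike k] {L : Type*} [LieRing L] [LieAlgebra k L]
    [FiniteDimensional k L] (L₀ : LieSubalgebra k L)
    (hcodim : LiePair.codim L₀ = 1) (heff : LiePair.AlmostEffective L₀) :
    (∃ n : ℕ, LiePair.Isomorphic L₀ (LiePair.hyperplane k n)) ∨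
    (∃ n : ℕ, LiePair.Isomorphic L₀ (LiePair.scalarAffineHyperplane k n)) ∨
    LiePair.Isomorphic L₀ (LiePair.st2 k) := by
  have : CharZero k := RCLike.charZero_rclike
  obtain ⟨f, hf⟩ := LiePair.exists_functional_of_codim_eq_one hcodim
  by_cases hK : LieIdeal.killingCompl k L ⊤ = ⊥
  · have : LieAlgebra.IsKilling k L := ⟨hK⟩
    have hf0 : f ≠ 0 := by
      rintro rfl
      have h1 : L₀.toSubmodule = ⊤ := eq_top_iff.2 fun x _ => (hf x).1 rfl
      rw [LiePair.codim, h1, Module.finrank_zero_of_subsingleton] at hcodim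
      exact zero_ne_one hcodim
    obtain ⟨e, he⟩ := LinearMap.surjective hf0 1
    exact Or.inr (Or.inr (LiePair.isomorphic_st2_of_isKilling heff hf he))
  · have : LieAlgebra.IsSolvable (LieIdeal.killingCompl k L ⊤) :=
      (LieAlgebra.LieIdeal.solvable_iff_le_radical k L _).2 (LieAlgebra.killingCompl_top_le_radical k L)
    have hab := LieAlgebra.abelian_derivedAbelianOfIdeal (LieIdeal.killingCompl k L ⊤)
    rw [← or_assoc]
    refine Or.inl (LiePair.isomorphic_of_abelian heff hf
      LiePair.isCharacteristic_killingCompl_top.derivedAbelianOfIdeal (fun x hx y hy => ?_)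
      (mt (LieAlgebra.abelian_of_solvable_ideal_eq_bot_iff _).1 hK))
    exact congrArg Subtype.val (hab.trivial ⟨x, hx⟩ ⟨y, hy⟩)
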